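/- For $f\in L^2((0,\infty))$ let $M[f](\tfrac12+it)=\int_0^\infty f(x)\,x^{-1/2+it}\,dx$ denote the Mellin–Plancherel transform on the critical line (the integral being understood in the $L^2$ sense), and for a bounded continuous $\psi:\mathbb R\to\mathbb R$ let $T_\psi$ be the bounded operator on $L^2((0,\infty))$ determined by $M[T_\psi f](\tfrac12+it)=\psi(t)\,M[f](\tfrac12+it)$ for almost every $t$. Let $\{\cdot\}$ denote the fractional part; for $0<\theta\le 1$ let $$f_\theta(x)=\{\theta/x\}-\theta\{1/x\}\quad(0<x\le 1),\qquad f_\theta(x)=0\quad(x>1),$$ and for $(j,k)\in\mathbb Z_{\ge0}^2$ let $\theta_{j,k}=2^{-j}3^{-k}$ and $d((j,k),(j',k'))=|j-j'|+|k-k'|$. Fix $\varepsilon>0$ and $W>0$, put $\psi_W(t)=\varepsilon+e^{-(t/W)^2}$ and $g_{\theta}=T_{\psi_W}f_{\theta}$. Let $G$ be the Gram matrix $$G_{(j,k),(j',k')}=\int_S g_{\theta_{j,k}}(x)\,\overline{g_{\theta_{j',k'}}(x)}\,dx,$$ where $S$ is either $(0,\infty)$ or $(0,1]$, and for an integer $B\ge1$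 let $G^{(B)}$ be the matrix obtained from $G$ by setting to zero every entry with $d((j,k),(j',k'))\ge B$. Then $G$ and all $G^{(B)}$ define bounded operators on $\ell^2(\mathbb Z_{\ge0}^2)$, and for every real $m>2$ there is a constant $C>0$, depending on $m$ and $W$ (and on the fixed parameter $\varepsilon$) but not on $B$, such that $$\|G-G^{(B)}\|_{\ell^2\to\ell^2}\le C\,B^{2-m}\qquad\text{for every integer } B\ge 1 .$$ -/

import Mathlib

open MeasureTheory Set FourierTransform
open scoped ENNReal ComplexConjugate

noncomputable section

namespace BeurlingNyman

/-! ### The Mellin–Plancherel transform and Mellin multipliers -/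

/-- The complex Hilbert space `L²((0,∞), dx)`. The space `L²((0,1])` sits inside it through
extension by zero. -/
abbrev HalfLine : Type := Lp ℂ 2 (volume.restrict (Ioi (0 : ℝ)))

/-- The complex Hilbert space `L²(ℝ)`. -/
abbrev Line : Type := Lp ℂ 2 (volume : Measure ℝ)

/-- Logarithmic change of variables `x = e^{-u}`: `f ↦ (u ↦ e^{-u/2} f(e^{-u}))`. -/
def toLog (f : ℝ → ℂ) (u : ℝ) : ℂ := (Real.exp (-(u / 2)) : ℂ) * f (Real.exp (-u))

/-- The inverse change of variables `h ↦ (x ↦ x^{-1/2} h(-log x))`. -/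
def ofLog (h : ℝ → ℂ) (x : ℝ) : ℂ := (Real.exp (-(Real.log x / 2)) : ℂ) * h (-Real.log x)

theorem image_exp_neg : (fun u : ℝ => Real.exp (-u)) '' univ = Ioi 0 := by
  ext x
  constructor
  · rintro ⟨u, -, rfl⟩
    exact Real.exp_pos _
  · intro hx
    exact ⟨-Real.log x, mem_univ _, by simp [Real.exp_log (mem_Ioi.1 hx)]⟩

theorem lintegral_exp_neg (g : ℝ → ℝ≥0∞) :
    ∫⁻ x in Ioi (0 : ℝ), g x = ∫⁻ u : ℝ, ENNReal.ofReal (Real.exp (-u)) * g (Real.exp (-u)) := by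
  have h := lintegral_image_eq_lintegral_abs_deriv_mul (s := univ)
    (f := fun u : ℝ => Real.exp (-u)) (f' := fun u => -Real.exp (-u)) MeasurableSet.univ
    (fun u _ => by simpa using (hasDerivAt_neg u).exp)
    (fun a _ b _ hab => by simpa using hab) g
  rw [image_exp_neg] at h
  simpa using h

theorem quasi_exp_neg :
    Measure.QuasiMeasurePreserving (fun u : ℝ => Real.exp (-u)) volume
      (volume.restrict (Ioi (0 : ℝ))) := by
  refine ⟨by fun_prop, ?_⟩
  refine Measure.AbsolutelyContinuous.mk fun s hs h0 => ?_
  rw [Measure.map_apply (by fun_prop) hs]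
  have h := lintegral_exp_neg (s.indicator 1)
  rw [lintegral_indicator_one hs, h0] at h
  have h2 := (lintegral_eq_zero_iff (by
    have : Measurable (s.indicator (1 : ℝ → ℝ≥0∞)) := measurable_one.indicator hs
    fun_prop)).1 h.symm
  refine measure_mono_null ?_ h2
  intro u hu
  have hu' : Real.exp (-u) ∈ s := hu
  simp [hu', Real.exp_pos]

theorem quasi_neg_log :
    Measure.QuasiMeasurePreserving (fun x : ℝ => -Real.log x)
      (volume.restrict (Ioi (0 : ℝ))) volume := by
  refine ⟨by fun_prop, ?_⟩
  refine Measure.AbsolutelyContinuous.mk fun s hs h0 => ?_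
  have hm : Measurable fun x : ℝ => -Real.log x := by fun_prop
  rw [Measure.map_apply hm hs, ← lintegral_indicator_one (hm hs), lintegral_exp_neg]
  have h1 : ∀ᵐ u : ℝ, u ∉ s := measure_eq_zero_iff_ae_notMem.1 h0
  rw [lintegral_congr_ae (g := fun _ => 0)]
  · simp
  · filter_upwards [h1] with u hu
    simp [hu]

theorem eLpNorm_toLog (f : ℝ → ℂ) :
    eLpNorm (toLog f) 2 volume = eLpNorm f 2 (volume.restrict (Ioi (0 : ℝ))) := by
  rw [eLpNorm_eq_lintegral_rpow_enorm_toReal (by simp) (by simp),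
    eLpNorm_eq_lintegral_rpow_enorm_toReal (by simp) (by simp), lintegral_exp_neg]
  congr 1
  refine lintegral_congr fun u => ?_
  have h1 : ‖(Real.exp (-(u / 2)) : ℂ)‖ₑ = ENNReal.ofReal (Real.exp (-(u / 2))) := by
    rw [← ofReal_norm, Complex.norm_real, Real.norm_of_nonneg (Real.exp_pos _).le]
  simp only [toLog, enorm_mul, h1, ENNReal.toReal_ofNat, ENNReal.rpow_two, mul_pow]
  rw [← ENNReal.ofReal_pow (Real.exp_pos _).le, ← Real.exp_nat_mul]
  congr 3
  push_cast
  ring_nf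

theorem toLog_ofLog (h : ℝ → ℂ) : toLog (ofLog h) = h := by
  funext u
  simp only [toLog, ofLog, Real.log_exp, neg_neg, ← mul_assoc, ← Complex.ofReal_mul,
    ← Real.exp_add]
  rw [show -(u / 2) + -(-u / 2) = 0 by ring]
  simp

theorem ofLog_toLog (f : ℝ → ℂ) {x : ℝ} (hx : 0 < x) : ofLog (toLog f) x = f x := by
  simp only [toLog, ofLog, neg_neg, Real.exp_log hx, ← mul_assoc, ← Complex.ofReal_mul,
    ← Real.exp_add]
  rw [show -(Real.log x / 2) + -(-Real.log x / 2) = 0 by ring]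
  simp

theorem toLog_congr {f g : ℝ → ℂ} (h : f =ᵐ[volume.restrict (Ioi (0 : ℝ))] g) :
    toLog f =ᵐ[volume] toLog g := by
  filter_upwards [quasi_exp_neg.ae h] with u hu
  simp only [toLog, hu]

theorem memLp_toLog {f : ℝ → ℂ} (hf : MemLp f 2 (volume.restrict (Ioi (0 : ℝ)))) :
    MemLp (toLog f) 2 volume := by
  refine ⟨?_, by rw [eLpNorm_toLog]; exact hf.2⟩
  exact (by fun_prop : Continuous fun u : ℝ => (Real.exp (-(u / 2)) : ℂ)).aestronglyMeasurable.mul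
    (hf.1.comp_quasiMeasurePreserving quasi_exp_neg)

theorem memLp_ofLog {h : ℝ → ℂ} (hh : MemLp h 2 volume) :
    MemLp (ofLog h) 2 (volume.restrict (Ioi (0 : ℝ))) := by
  refine ⟨?_, by rw [← eLpNorm_toLog, toLog_ofLog]; exact hh.2⟩
  exact (by fun_prop : Measurable fun x : ℝ =>
      (Real.exp (-(Real.log x / 2)) : ℂ)).aestronglyMeasurable.mul
    (hh.1.comp_quasiMeasurePreserving quasi_neg_log)

/-- The unitary map `L²((0,∞)) → L²(ℝ)`, `f ↦ (u ↦ e^{-u/2} f(e^{-u}))`. -/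
def logEquiv : HalfLine ≃ₗᵢ[ℂ] Line where
  toFun f := (memLp_toLog (Lp.memLp f)).toLp (toLog f)
  invFun h := (memLp_ofLog (Lp.memLp h)).toLp (ofLog h)
  map_add' f g := by
    rw [← MemLp.toLp_add, MemLp.toLp_eq_toLp_iff]
    filter_upwards [toLog_congr (Lp.coeFn_add f g)] with u hu
    rw [hu]
    simp [toLog, mul_add]
  map_smul' c f := by
    rw [RingHom.id_apply, ← MemLp.toLp_const_smul, MemLp.toLp_eq_toLp_iff]
    filter_upwards [toLog_congr (Lp.coeFn_smul c f)] with u hu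
    rw [hu]
    simp [toLog, mul_left_comm]
  left_inv f := by
    refine Lp.ext ?_
    refine (MemLp.coeFn_toLp _).trans ?_
    have h := quasi_neg_log.ae (MemLp.coeFn_toLp (memLp_toLog (Lp.memLp f)))
    filter_upwards [h, ae_restrict_mem measurableSet_Ioi] with x hx hx0
    rw [← ofLog_toLog f hx0]
    simp only [ofLog, hx]
  right_inv h := by
    refine Lp.ext ?_
    refine (MemLp.coeFn_toLp _).trans ?_
    refine (toLog_congr (MemLp.coeFn_toLp (memLp_ofLog (Lp.memLp h)))).trans ?_
    rw [toLog_ofLog]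
  norm_map' f := by
    change ‖(memLp_toLog (Lp.memLp f)).toLp (toLog f)‖ = ‖f‖
    rw [Lp.norm_toLp, eLpNorm_toLog, Lp.norm_def]

/-- The Mellin–Plancherel transform of `f ∈ L²((0,∞))` on the critical line, as a function of `t`
(defined up to null sets): the `L²`-version of `M[f](1/2 + it) = ∫₀^∞ f(x) x^{-1/2+it} dx`. In the
variable `x = e^{-u}` it is the Fourier transform, and the normalisation of the latter
(`e^{-2πiuξ}`) puts `ξ = t / 2π`. -/
def mellinLine (f : HalfLine) (t : ℝ) : ℂ := (𝓕 (logEquiv f) : Line) (t / (2 * Real.pi))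

/-- A bounded continuous multiplier is in `L^∞`; it is written in the Fourier variable `ξ = t / 2π`. -/
theorem memLp_multiplier (ψ : BoundedContinuousFunction ℝ ℝ) :
    MemLp (fun ξ : ℝ => (ψ (2 * Real.pi * ξ) : ℂ)) ∞ volume := by
  refine memLp_top_of_bound (C := ‖ψ‖) ?_ (Filter.Eventually.of_forall fun ξ => ?_)
  · exact (by fun_prop : Continuous fun ξ : ℝ =>
      (ψ (2 * Real.pi * ξ) : ℂ)).aestronglyMeasurable
  · rw [Complex.norm_real]
    exact ψ.norm_coe_le_norm _

/-- Multiplication by `ξ ↦ ψ(2πξ)` on `L²(ℝ)`. -/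
def mulLine (ψ : BoundedContinuousFunction ℝ ℝ) : Line →L[ℂ] Line :=
  (ContinuousLinearMap.mul ℂ ℂ).holderL volume ∞ 2 2 ((memLp_multiplier ψ).toLp _)

/-- The Mellin multiplier `T_ψ`, characterised by `M[T_ψ f](1/2 + it) = ψ(t) M[f](1/2 + it)`.
It acts on `L²((0,∞))`; for a general `ψ` it does not preserve the subspace of functions supported
in `(0,1]`. -/
def mellinMultiplier (ψ : BoundedContinuousFunction ℝ ℝ) : HalfLine →L[ℂ] HalfLine :=
  (logEquiv.symm.toContinuousLinearEquiv : Line →L[ℂ] HalfLine) ∘L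
    ((Lp.fourierTransformₗᵢ ℝ ℂ).symm.toContinuousLinearEquiv : Line →L[ℂ] Line) ∘L
    mulLine ψ ∘L
    ((Lp.fourierTransformₗᵢ ℝ ℂ).toContinuousLinearEquiv : Line →L[ℂ] Line) ∘L
    (logEquiv.toContinuousLinearEquiv : HalfLine →L[ℂ] Line)

/-- The scaling `t ↦ t / 2π` respects null sets. -/
theorem ae_scale {p : ℝ → Prop} (h : ∀ᵐ ξ : ℝ, p ξ) : ∀ᵐ t : ℝ, p (t / (2 * Real.pi)) := by
  have hq : Measure.QuasiMeasurePreserving (fun t : ℝ => (2 * Real.pi)⁻¹ • t)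
      (volume : Measure ℝ) volume := by
    refine ⟨by fun_prop, ?_⟩
    rw [Measure.map_addHaar_smul _ (by positivity)]
    exact Measure.smul_absolutelyContinuous
  filter_upwards [hq.ae h] with t ht
  simpa [div_eq_inv_mul] using ht

/-- The defining property of `T_ψ`. -/
theorem mellinLine_mellinMultiplier (ψ : BoundedContinuousFunction ℝ ℝ) (f : HalfLine) :
    ∀ᵐ t : ℝ, mellinLine (mellinMultiplier ψ f) t = (ψ t : ℂ) * mellinLine f t := by
  have h0 : (𝓕 (logEquiv (mellinMultiplier ψ f)) : Line) = mulLine ψ (𝓕 (logEquiv f)) := by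
    change Lp.fourierTransformₗᵢ ℝ ℂ (logEquiv (logEquiv.symm
      ((Lp.fourierTransformₗᵢ ℝ ℂ).symm (mulLine ψ _)))) = _
    rw [LinearIsometryEquiv.apply_symm_apply, LinearIsometryEquiv.apply_symm_apply]
    rfl
  have h1 : ∀ᵐ ξ : ℝ, (mulLine ψ (𝓕 (logEquiv f)) : Line) ξ =
      (ψ (2 * Real.pi * ξ) : ℂ) * (𝓕 (logEquiv f) : Line) ξ := by
    filter_upwards [(ContinuousLinearMap.mul ℂ ℂ).coeFn_holder (r := 2)
      ((memLp_multiplier ψ).toLp _) (𝓕 (logEquiv f) : Line),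
      MemLp.coeFn_toLp (memLp_multiplier ψ)] with ξ h2 h3
    refine h2.trans ?_
    rw [h3]
    rfl
  filter_upwards [ae_scale h1] with t ht
  have hp : (2 * Real.pi) * (t / (2 * Real.pi)) = t := by field_simp
  rw [hp] at ht
  simp only [mellinLine, h0, ht]

/-- Fourier transforms in `L¹` and in `L²` agree on `L¹ ∩ L²`. -/
theorem fourier_toLp_ae {h : ℝ → ℂ} (h1 : Integrable h) (h2 : MemLp h 2 volume) :
    (𝓕 (h2.toLp h) : Line) =ᵐ[volume] 𝓕 h := by
  have hcont : Continuous (𝓕 h) :=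
    VectorFourier.fourierIntegral_continuous Real.continuous_fourierChar
      (by exact continuous_inner) h1
  refine ae_eq_of_integral_contDiff_smul_eq ((Lp.memLp _).locallyIntegrable (by norm_num))
    hcont.locallyIntegrable fun g hg hgc => ?_
  have hg1 : HasCompactSupport (Complex.ofRealCLM ∘ g) := hgc.comp_left rfl
  have hg2 : ContDiff ℝ (⊤ : ℕ∞) (Complex.ofRealCLM ∘ g) := by fun_prop
  have e := congrArg (fun T : TemperedDistribution ℝ ℂ => T (hg1.toSchwartzMap hg2))
    (Lp.fourier_toTemperedDistribution_eq (h2.toLp h))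
  simp only [TemperedDistribution.fourier_apply, Lp.toTemperedDistribution_apply] at e
  have e2 := VectorFourier.integral_fourierIntegral_smul_eq_flip (L := innerₗ ℝ)
    (μ := volume) (ν := volume) Real.continuous_fourierChar continuous_inner h1
    (hg1.toSchwartzMap hg2).integrable
  calc ∫ x, g x • (𝓕 (h2.toLp h) : Line) x
      = ∫ x, (hg1.toSchwartzMap hg2) x • (𝓕 (h2.toLp h) : Line) x := by
        simp
    _ = ∫ x, (𝓕 (hg1.toSchwartzMap hg2)) x • (h2.toLp h) x := e.symm
    _ = ∫ x, h x • 𝓕 (fun y => (hg1.toSchwartzMap hg2) y) x := by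
        refine integral_congr_ae ?_
        filter_upwards [MemLp.coeFn_toLp h2] with x hx
        rw [hx, smul_eq_mul, smul_eq_mul, mul_comm, SchwartzMap.fourier_coe]
    _ = ∫ x, 𝓕 h x • (hg1.toSchwartzMap hg2) x := by
        rw [flip_innerₗ] at e2
        exact e2.symm
    _ = ∫ x, g x • 𝓕 h x := by
        simp [mul_comm]

/-- The `L²` Mellin transform is the Mellin integral wherever that converges absolutely. -/
theorem mellinLine_eq_mellin {f : ℝ → ℂ} (hf : MemLp f 2 (volume.restrict (Ioi (0 : ℝ))))
    (hc : MellinConvergent f (1 / 2)) :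
    ∀ᵐ t : ℝ, mellinLine (hf.toLp f) t = mellin f (1 / 2 + t * Complex.I) := by
  have hL : logEquiv (hf.toLp f) = (memLp_toLog hf).toLp (toLog f) := by
    refine Lp.ext ((MemLp.coeFn_toLp (memLp_toLog (Lp.memLp (hf.toLp f)))).trans ?_)
    exact (toLog_congr (MemLp.coeFn_toLp hf)).trans (MemLp.coeFn_toLp _).symm
  have hI : Integrable (toLog f) := by
    rw [MellinConvergent, ← image_exp_neg] at hc
    have h := (integrableOn_image_iff_integrableOn_abs_deriv_smul (s := univ)
      (f := fun u : ℝ => Real.exp (-u)) (f' := fun u => -Real.exp (-u)) MeasurableSet.univ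
      (fun u _ => by simpa using (hasDerivAt_neg u).exp)
      (fun a _ b _ hab => by simpa using hab) _).1 hc
    rw [integrableOn_univ] at h
    refine h.congr (Filter.Eventually.of_forall fun u => ?_)
    simp only [toLog, abs_neg, abs_of_pos (Real.exp_pos _), Complex.real_smul, smul_eq_mul,
      ← mul_assoc]
    congr 1
    rw [show ((1 : ℂ) / 2 - 1) = ((-(1 / 2) : ℝ) : ℂ) by push_cast; ring,
      ← Complex.ofReal_cpow (Real.exp_pos _).le, ← Real.exp_mul, ← Complex.ofReal_mul,
      ← Real.exp_add]
    congr 2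
    ring
  have h := ae_scale (fourier_toLp_ae hI (memLp_toLog hf))
  filter_upwards [h] with t ht
  rw [mellinLine, hL, ht, mellin_eq_fourier]
  have him : ((1 : ℂ) / 2 + t * Complex.I).im = t := by simp
  have hre : ((1 : ℂ) / 2 + t * Complex.I).re = 1 / 2 := by simp
  rw [him, hre]
  refine congrArg _ (funext fun u => ?_)
  simp only [toLog, Complex.real_smul, show -(1 / 2 : ℝ) * u = -(u / 2) by ring]

/-! ### The smoothed ladder system and its Gram matrix -/

/-- The Beurling–Nyman function `f_θ(x) = {θ/x} - θ{1/x}` on `(0,1]`, extended by zero. -/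
def bnFun (θ : ℝ) : ℝ → ℂ :=
  (Ioc (0 : ℝ) 1).indicator fun x => ((Int.fract (θ / x) - θ * Int.fract (1 / x) : ℝ) : ℂ)

theorem memLp_bnFun (θ : ℝ) : MemLp (bnFun θ) 2 (volume.restrict (Ioi (0 : ℝ))) := by
  have hm : Measurable fun x : ℝ =>
      ((Int.fract (θ / x) - θ * Int.fract (1 / x) : ℝ) : ℂ) := by fun_prop
  refine MemLp.restrict _ ?_
  rw [bnFun, memLp_indicator_iff_restrict measurableSet_Ioc]
  refine MemLp.of_bound hm.aestronglyMeasurable (1 + |θ|) (Filter.Eventually.of_forall fun x => ?_)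
  rw [Complex.norm_real]
  refine (norm_sub_le _ _).trans (add_le_add ?_ ?_)
  · rw [Real.norm_of_nonneg (Int.fract_nonneg _)]
    exact (Int.fract_lt_one _).le
  · rw [norm_mul, Real.norm_of_nonneg (Int.fract_nonneg _), Real.norm_eq_abs]
    exact mul_le_of_le_one_right (abs_nonneg _) (Int.fract_lt_one _).le

/-- `f_θ` as a vector of the Hilbert space. -/
def bnVec (θ : ℝ) : HalfLine := (memLp_bnFun θ).toLp (bnFun θ)

/-- The ladder parameters `θ_{j,k} = 2^{-j} 3^{-k}`. -/
def ladder (p : ℕ × ℕ) : ℝ := ((2 : ℝ) ^ p.1)⁻¹ * ((3 : ℝ) ^ p.2)⁻¹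

/-- The ladder distance `|j - j'| + |k - k'|`. -/
def ladderDist (p q : ℕ × ℕ) : ℕ :=
  ((p.1 : ℤ) - q.1).natAbs + ((p.2 : ℤ) - q.2).natAbs

/-- The Gaussian-type weight `ψ_W(t) = ε + e^{-(t/W)²}`. -/
def gaussWeight (ε W : ℝ) : BoundedContinuousFunction ℝ ℝ :=
  BoundedContinuousFunction.ofNormedAddCommGroup (fun t => ε + Real.exp (-(t / W) ^ 2))
    (by fun_prop) (|ε| + 1) fun t => by
      refine (norm_add_le _ _).trans (add_le_add le_rfl ?_)
      rw [Real.norm_of_nonneg (Real.exp_pos _).le, Real.exp_le_one_iff]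
      exact neg_nonpos.2 (sq_nonneg _)

/-- The smoothed ladder vectors `g_{θ_{j,k}} = T_{ψ_W} f_{θ_{j,k}}`. -/
def smoothed (ε W : ℝ) (p : ℕ × ℕ) : HalfLine :=
  mellinMultiplier (gaussWeight ε W) (bnVec (ladder p))

/-- The Gram matrix `(∫_S g_p(x) conj(g_q(x)) dx)_{p,q}` of the smoothed ladder system, for the
inner product of `L²(S)`, where `S ⊆ (0,∞)`. For `S = (0,∞)` this is the Gram matrix in the space
on which `T_{ψ_W}` acts (and for which Mellin–Parseval on the critical line holds), for `S = (0,1]`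
it is the Gram matrix of the restrictions of the `g_p` to `(0,1]`. -/
def gram (S : Set ℝ) (ε W : ℝ) (p q : ℕ × ℕ) : ℂ :=
  ∫ x in S, smoothed ε W p x * conj (smoothed ε W q x)

/-- The truncation of a matrix: entries at ladder distance at least `B` are set to zero. -/
def truncate (B : ℕ) (M : ℕ × ℕ → ℕ × ℕ → ℂ) (p q : ℕ × ℕ) : ℂ :=
  if B ≤ ladderDist p q then 0 else M p q

/-- The Hilbert space `ℓ²(ℤ_{≥0}²)`. -/
abbrev LadderSpace : Type := lp (fun _ : ℕ × ℕ => ℂ) 2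

/-- The bounded operator `A` on `ℓ²(ℤ_{≥0}²)` is given by the matrix `M`:
`(A x)_p = ∑_q M_{p,q} x_q` for every `x`, with convergent sums. -/
def IsMatrixOf (M : ℕ × ℕ → ℕ × ℕ → ℂ) (A : LadderSpace →L[ℂ] LadderSpace) : Prop :=
  ∀ (x : LadderSpace) (p : ℕ × ℕ), HasSum (fun q => M p q * x q) (A x p)

end BeurlingNyman

end

/-!
The Gram matrix is Hilbert–Schmidt, with entries decaying exponentially in the ladder distance.

For `0 < θ ≤ 1` the function `f_θ` satisfies both `|f_θ| ≤ 1` and `|f_θ(x)| ≤ θ / x`, because on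
`(θ, 1]` it equals `θ ⌊1/x⌋`. Interpolating gives `|f_θ(x)|² ≤ (θ / x)^{1/2}`, hence
`‖f_θ‖² ≤ 2 θ^{1/2}` (`norm_bnVec_sq_le`). Since `T_ψ` is bounded and
`θ_{j,k} ≤ 2^{-(j+k)}`, Cauchy–Schwarz over `S` yields
`|G_{p,q}|² ≤ K ρ^{|p|+|q|}` with `ρ = 2^{-1/2}` and `|(j,k)| = j + k`
(`exists_norm_gram_sq_le`).

A matrix with square-summable entries is the matrix of an operator whose norm is at most its
Hilbert–Schmidt norm (`exists_isMatrixOf_of_summable`). This gives `G`. The matrix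
`G - G^{(B)}` is supported on pairs with `|p| + |q| ≥ d(p,q) ≥ B`, so half of the exponent
`|p| + |q|` pays for a factor `ρ^{B/2}` and the other half keeps the squares summable. Thus
`‖G - G^{(B)}‖` is exponentially small in `B`, which is stronger than any power of `B`.
-/

namespace BeurlingNyman

open MeasureTheory Set
open scoped ENNReal ComplexConjugate

/-! ### Hilbert–Schmidt matrices -/

/-- A matrix with square-summable entries defines a bounded operator on `ℓ²`, whose norm is at most
the Hilbert–Schmidt norm of the matrix. -/
theorem exists_isMatrixOf_of_summable {M : ℕ × ℕ → ℕ × ℕ → ℂ}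
    (hM : Summable fun z : (ℕ × ℕ) × (ℕ × ℕ) => ‖M z.1 z.2‖ ^ 2) :
    ∃ A : LadderSpace →L[ℂ] LadderSpace, IsMatrixOf M A ∧
      ‖A‖ ≤ √(∑' z : (ℕ × ℕ) × (ℕ × ℕ), ‖M z.1 z.2‖ ^ 2) := by
  have h2 : (0 : ℝ) < (2 : ℝ≥0∞).toReal := by norm_num
  have hrow (p : ℕ × ℕ) : Summable fun q => ‖M p q‖ ^ 2 := hM.prod_factor p
  have hmem (p : ℕ × ℕ) : Memℓp (fun q => conj (M p q)) 2 :=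
    memℓp_gen (by simpa using hrow p)
  -- The inner product is conjugate-linear in its first argument, hence the conjugated rows.
  let R (p : ℕ × ℕ) : LadderSpace := ⟨fun q => conj (M p q), hmem p⟩
  have hR (p : ℕ × ℕ) : ‖R p‖ ^ 2 = ∑' q, ‖M p q‖ ^ 2 := by
    have h := lp.norm_rpow_eq_tsum h2 (R p)
    simpa [R] using h
  have hR2 : Summable fun p => ‖R p‖ ^ 2 := by
    simp only [hR]
    exact hM.prod
  have hRsum : ∑' p, ‖R p‖ ^ 2 = ∑' z : (ℕ × ℕ) × (ℕ × ℕ), ‖M z.1 z.2‖ ^ 2 := by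
    simp only [hR]
    exact (hM.tsum_prod' hrow).symm
  have hle (x : LadderSpace) (p : ℕ × ℕ) : ‖inner ℂ (R p) x‖ ^ 2 ≤ ‖R p‖ ^ 2 * ‖x‖ ^ 2 := by
    rw [← mul_pow]
    gcongr
    exact norm_inner_le_norm _ _
  have hsum (x : LadderSpace) : Summable fun p => ‖inner ℂ (R p) x‖ ^ 2 :=
    Summable.of_nonneg_of_le (fun _ => by positivity) (hle x) (hR2.mul_right _)
  let L : LadderSpace →ₗ[ℂ] LadderSpace :=
    { toFun := fun x => ⟨fun p => inner ℂ (R p) x, memℓp_gen (by simpa using hsum x)⟩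
      map_add' := fun x y => by
        ext p
        exact inner_add_right _ _ _
      map_smul' := fun c x => by
        ext p
        exact inner_smul_right _ _ _ }
  have hL (x : LadderSpace) :
      ‖L x‖ ≤ √(∑' z : (ℕ × ℕ) × (ℕ × ℕ), ‖M z.1 z.2‖ ^ 2) * ‖x‖ := by
    refine lp.norm_le_of_tsum_le h2 (by positivity) ?_
    simp only [ENNReal.toReal_ofNat, Real.rpow_two, mul_pow]
    rw [Real.sq_sqrt (tsum_nonneg fun _ => by positivity), ← hRsum, ← tsum_mul_right]
    exact (hsum x).tsum_le_tsum (hle x) (hR2.mul_right _)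
  refine ⟨L.mkContinuous _ hL, fun x p => ?_, L.mkContinuous_norm_le (Real.sqrt_nonneg _) hL⟩
  have h : HasSum (fun q => inner ℂ (R p q) (x q)) (L x p) := lp.hasSum_inner (R p) x
  have hterm : (fun q => inner ℂ (R p q) (x q)) = fun q => M p q * x q := by
    funext q
    simp [R, mul_comm]
  rw [hterm] at h
  exact h

/-! ### The size of the Beurling–Nyman functions -/

theorem norm_bnFun_sq_le {θ x : ℝ} (hθ : 0 < θ) (hθ1 : θ ≤ 1) (hx : x ∈ Ioc (0 : ℝ) 1) :
    ‖bnFun θ x‖ ^ 2 ≤ θ ^ (1 / 2 : ℝ) * x ^ (-(1 / 2) : ℝ) := by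
  obtain ⟨hx0, hx1⟩ := hx
  have hform : θ ^ (1 / 2 : ℝ) * x ^ (-(1 / 2) : ℝ) = (θ / x) ^ (1 / 2 : ℝ) := by
    rw [Real.div_rpow hθ.le hx0.le, Real.rpow_neg hx0.le, ← div_eq_mul_inv]
  rw [hform, bnFun, indicator_of_mem (show x ∈ Ioc (0 : ℝ) 1 from ⟨hx0, hx1⟩), Complex.norm_real, Real.norm_eq_abs]
  have hf0 := Int.fract_nonneg (θ / x)
  have hf1 := Int.fract_lt_one (θ / x)
  have hg0 := Int.fract_nonneg (1 / x)
  have hg1 := Int.fract_lt_one (1 / x)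
  have hone : |Int.fract (θ / x) - θ * Int.fract (1 / x)| ≤ 1 := by
    rw [abs_le]
    constructor <;> nlinarith [mul_nonneg hθ.le hg0]
  rcases le_or_gt x θ with h | h
  · refine (pow_le_one₀ (abs_nonneg _) hone).trans ?_
    exact Real.one_le_rpow ((one_le_div hx0).2 h) (by norm_num)
  · have hy0 : 0 ≤ θ / x := by positivity
    have hy1 : θ / x < 1 := (div_lt_one hx0).2 h
    have hfr : Int.fract (θ / x) = θ / x := Int.fract_eq_self.2 ⟨hy0, hy1⟩
    -- Here `f_θ(x) = θ (1/x - {1/x})` lies between `0` and `θ / x`.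
    have hfx : Int.fract (1 / x) ≤ 1 / x := by
      rw [← Int.self_sub_floor]
      have : (0 : ℝ) ≤ ⌊1 / x⌋ := by exact_mod_cast Int.floor_nonneg.2 (by positivity)
      linarith
    have habs : |Int.fract (θ / x) - θ * Int.fract (1 / x)| ≤ θ / x := by
      have hθx : θ / x = θ * (1 / x) := by ring
      rw [hfr, abs_of_nonneg]
      · nlinarith [mul_nonneg hθ.le hg0]
      · rw [hθx]
        nlinarith
    calc |Int.fract (θ / x) - θ * Int.fract (1 / x)| ^ 2 ≤ (θ / x) ^ 2 := by gcongr
      _ = (θ / x) ^ (2 : ℝ) := (Real.rpow_two _).symm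
      _ ≤ (θ / x) ^ (1 / 2 : ℝ) :=
        Real.rpow_le_rpow_of_exponent_ge (by positivity) hy1.le (by norm_num)

/-- `f_θ` is small in `L²` when `θ` is small. This is the source of all decay of the Gram matrix. -/
theorem norm_bnVec_sq_le {θ : ℝ} (hθ : 0 < θ) (hθ1 : θ ≤ 1) :
    ‖bnVec θ‖ ^ 2 ≤ 2 * θ ^ (1 / 2 : ℝ) := by
  have hmem := memLp_bnFun θ
  have hnorm : ‖bnVec θ‖ ^ 2 = ∫ x in Ioi (0 : ℝ), ‖bnFun θ x‖ ^ 2 := by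
    rw [bnVec, Lp.norm_toLp, hmem.eLpNorm_eq_integral_rpow_norm (by simp) (by simp)]
    have h0 : 0 ≤ ∫ x in Ioi (0 : ℝ), ‖bnFun θ x‖ ^ 2 :=
      integral_nonneg fun _ => by positivity
    simp only [ENNReal.toReal_ofNat, Real.rpow_two]
    rw [ENNReal.toReal_ofReal (by positivity), ← Real.rpow_two, ← Real.rpow_mul h0]
    norm_num
  have hint : IntegrableOn (fun x : ℝ => θ ^ (1 / 2 : ℝ) * x ^ (-(1 / 2) : ℝ)) (Ioc 0 1) := by
    refine Integrable.const_mul ?_ _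
    exact (intervalIntegrable_iff_integrableOn_Ioc_of_le zero_le_one).1
      (intervalIntegral.intervalIntegrable_rpow' (by norm_num))
  have hsupp : ∫ x in Ioi (0 : ℝ), ‖bnFun θ x‖ ^ 2 = ∫ x in Ioc (0 : ℝ) 1, ‖bnFun θ x‖ ^ 2 := by
    refine setIntegral_eq_of_subset_of_forall_sdiff_eq_zero measurableSet_Ioi
      Ioc_subset_Ioi_self fun x hx => ?_
    simp [bnFun, indicator_of_notMem hx.2]
  have hsq : IntegrableOn (fun x => ‖bnFun θ x‖ ^ 2) (Ioc 0 1) :=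
    IntegrableOn.mono_set ((memLp_two_iff_integrable_sq_norm hmem.1).1 hmem) fun x hx => hx.1
  rw [hnorm, hsupp]
  calc ∫ x in Ioc (0 : ℝ) 1, ‖bnFun θ x‖ ^ 2
      ≤ ∫ x in Ioc (0 : ℝ) 1, θ ^ (1 / 2 : ℝ) * x ^ (-(1 / 2) : ℝ) :=
        setIntegral_mono_on hsq hint measurableSet_Ioc fun x hx => norm_bnFun_sq_le hθ hθ1 hx
    _ = 2 * θ ^ (1 / 2 : ℝ) := by
        rw [integral_const_mul, ← intervalIntegral.integral_of_le zero_le_one,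
          integral_rpow (Or.inl (by norm_num))]
        norm_num
        ring

theorem ladder_pos (p : ℕ × ℕ) : 0 < ladder p := by
  unfold ladder
  positivity

theorem ladder_le (p : ℕ × ℕ) : ladder p ≤ (1 / 2) ^ (p.1 + p.2) := by
  rw [ladder, pow_add, one_div, inv_pow, inv_pow]
  gcongr
  norm_num

/-! ### Decay of the Gram matrix -/

theorem norm_gram_le {S : Set ℝ} (hS : S ⊆ Ioi 0) (ε W : ℝ) (p q : ℕ × ℕ) :
    ‖gram S ε W p q‖ ≤ ‖smoothed ε W p‖ * ‖smoothed ε W q‖ := by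
  set u := smoothed ε W p
  set v := smoothed ε W q
  have hv : AEStronglyMeasurable (fun x => conj (v x)) (volume.restrict (Ioi (0 : ℝ))) :=
    Complex.continuous_conj.comp_aestronglyMeasurable (Lp.aestronglyMeasurable v)
  have hconj : eLpNorm (fun x => conj (v x)) 2 (volume.restrict (Ioi (0 : ℝ))) =
      eLpNorm v 2 (volume.restrict (Ioi (0 : ℝ))) :=
    eLpNorm_congr_norm_ae (Filter.Eventually.of_forall fun x => by simp)
  have h : ‖gram S ε W p q‖ₑ ≤ ‖u‖ₑ * ‖v‖ₑ := by
    calc ‖gram S ε W p q‖ₑ ≤ ∫⁻ x in S, ‖u x * conj (v x)‖ₑ := enorm_integral_le_lintegral_enorm _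
      _ ≤ ∫⁻ x in Ioi (0 : ℝ), ‖u x * conj (v x)‖ₑ := lintegral_mono_set hS
      _ = eLpNorm (⇑u • fun x => conj (v x)) 1 (volume.restrict (Ioi (0 : ℝ))) := by
        rw [eLpNorm_one_eq_lintegral_enorm]
        rfl
      _ ≤ eLpNorm u 2 (volume.restrict (Ioi (0 : ℝ))) *
          eLpNorm (fun x => conj (v x)) 2 (volume.restrict (Ioi (0 : ℝ))) :=
        eLpNorm_smul_le_mul_eLpNorm hv (Lp.aestronglyMeasurable u)
      _ = ‖u‖ₑ * ‖v‖ₑ := by rw [hconj, Lp.enorm_def, Lp.enorm_def]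
  rw [← enorm_norm u, ← enorm_norm v, ← enorm_mul] at h
  simpa using (enorm_le_iff_norm_le.1 h)

/-- The squared Gram entries decay exponentially in both indices. The bound is stated with the base
`(2^{-1/4})²`, so that one of the two factors can be spent on a power of the ladder distance. -/
theorem exists_norm_gram_sq_le {S : Set ℝ} (hS : S ⊆ Ioi 0) (ε W : ℝ) :
    ∃ K : ℝ, 0 ≤ K ∧ ∀ p q : ℕ × ℕ, ‖gram S ε W p q‖ ^ 2 ≤
      K * (((1 / 2 : ℝ) ^ (1 / 4 : ℝ)) ^ 2) ^ (p.1 + p.2 + (q.1 + q.2)) := by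
  set T := mellinMultiplier (gaussWeight ε W)
  set r : ℝ := ((1 / 2 : ℝ) ^ (1 / 4 : ℝ)) ^ 2 with hr
  have hr' : r = (1 / 2 : ℝ) ^ (1 / 2 : ℝ) := by
    rw [hr, ← Real.rpow_natCast, ← Real.rpow_mul (by norm_num)]
    norm_num
  have hvec (p : ℕ × ℕ) : ‖smoothed ε W p‖ ^ 2 ≤ ‖T‖ ^ 2 * 2 * r ^ (p.1 + p.2) := by
    have hle1 : ladder p ≤ 1 :=
      (ladder_le p).trans (pow_le_one₀ (by norm_num) (by norm_num))
    have hroot : ladder p ^ (1 / 2 : ℝ) ≤ r ^ (p.1 + p.2) := by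
      rw [hr', Real.rpow_pow_comm (by norm_num)]
      exact Real.rpow_le_rpow (ladder_pos p).le (ladder_le p) (by norm_num)
    calc ‖smoothed ε W p‖ ^ 2 ≤ (‖T‖ * ‖bnVec (ladder p)‖) ^ 2 := by
          gcongr
          exact T.le_opNorm _
      _ = ‖T‖ ^ 2 * ‖bnVec (ladder p)‖ ^ 2 := mul_pow _ _ _
      _ ≤ ‖T‖ ^ 2 * (2 * ladder p ^ (1 / 2 : ℝ)) := by
          gcongr
          exact norm_bnVec_sq_le (ladder_pos p) hle1
      _ ≤ ‖T‖ ^ 2 * (2 * r ^ (p.1 + p.2)) := by gcongr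
      _ = ‖T‖ ^ 2 * 2 * r ^ (p.1 + p.2) := by ring
  refine ⟨(‖T‖ ^ 2 * 2) ^ 2, by positivity, fun p q => ?_⟩
  calc ‖gram S ε W p q‖ ^ 2 ≤ (‖smoothed ε W p‖ * ‖smoothed ε W q‖) ^ 2 := by
        gcongr
        exact norm_gram_le hS ε W p q
    _ = ‖smoothed ε W p‖ ^ 2 * ‖smoothed ε W q‖ ^ 2 := mul_pow _ _ _
    _ ≤ (‖T‖ ^ 2 * 2 * r ^ (p.1 + p.2)) * (‖T‖ ^ 2 * 2 * r ^ (q.1 + q.2)) :=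
        mul_le_mul (hvec p) (hvec q) (by positivity) (by positivity)
    _ = (‖T‖ ^ 2 * 2) ^ 2 * r ^ (p.1 + p.2 + (q.1 + q.2)) := by ring

theorem ladderDist_le (p q : ℕ × ℕ) : ladderDist p q ≤ p.1 + p.2 + (q.1 + q.2) := by
  unfold ladderDist
  omega

theorem summable_pow_pair {s : ℝ} (hs : 0 ≤ s) (hs1 : s < 1) :
    Summable fun z : (ℕ × ℕ) × (ℕ × ℕ) => s ^ (z.1.1 + z.1.2 + (z.2.1 + z.2.2)) := by
  have h0 := summable_geometric_of_lt_one hs hs1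
  have h1 : Summable fun p : ℕ × ℕ => s ^ (p.1 + p.2) := by
    simpa only [pow_add] using
      h0.mul_of_nonneg h0 (fun _ => pow_nonneg hs _) fun _ => pow_nonneg hs _
  simpa only [pow_add] using
    h1.mul_of_nonneg h1 (fun _ => pow_nonneg hs _) fun _ => pow_nonneg hs _

theorem exists_pow_le_mul_rpow {r : ℝ} (hr : 0 < r) (hr1 : r < 1) (s : ℝ) :
    ∃ D : ℝ, 0 < D ∧ ∀ n : ℕ, 1 ≤ n → r ^ n ≤ D * (n : ℝ) ^ s := by
  have hlim := (tendsto_rpow_mul_exp_neg_mul_atTop_nhds_zero (-s) (-Real.log r)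
    (neg_pos.2 (Real.log_neg hr hr1))).comp tendsto_natCast_atTop_atTop
  obtain ⟨D, hD⟩ := hlim.bddAbove_range
  refine ⟨max D 1, by positivity, fun n hn => ?_⟩
  have hn0 : (0 : ℝ) < n := by exact_mod_cast hn
  have h : (n : ℝ) ^ (-s) * r ^ n ≤ max D 1 := by
    refine le_trans (le_of_eq ?_) ((hD (mem_range_self n)).trans (le_max_left _ _))
    simp only [Function.comp, neg_neg]
    rw [← Real.rpow_natCast, Real.rpow_def_of_pos hr]
  calc r ^ n = ((n : ℝ) ^ (-s) * r ^ n) * (n : ℝ) ^ s := by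
        rw [mul_right_comm, ← Real.rpow_add hn0]
        simp
    _ ≤ max D 1 * (n : ℝ) ^ s := by gcongr

/-- The Gram matrix beyond ladder distance `B` has an exponentially small operator norm. -/
theorem exists_isMatrixOf_gram_sub_truncate {S : Set ℝ} (hS : S ⊆ Ioi 0) (ε W : ℝ) :
    ∃ r C : ℝ, 0 < r ∧ r < 1 ∧ 0 ≤ C ∧ ∀ B : ℕ, ∃ A : LadderSpace →L[ℂ] LadderSpace,
      IsMatrixOf (fun p q => gram S ε W p q - truncate B (gram S ε W) p q) A ∧
      ‖A‖ ≤ C * r ^ B := by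
  obtain ⟨K, hK, hG⟩ := exists_norm_gram_sq_le hS ε W
  set s : ℝ := (1 / 2 : ℝ) ^ (1 / 4 : ℝ)
  have hs0 : 0 < s := by positivity
  have hs1 : s < 1 := Real.rpow_lt_one (by norm_num) (by norm_num) (by norm_num)
  clear_value s
  have hsum := summable_pow_pair hs0.le hs1
  refine ⟨√s, √(K * ∑' z : (ℕ × ℕ) × (ℕ × ℕ), s ^ (z.1.1 + z.1.2 + (z.2.1 + z.2.2))),
    Real.sqrt_pos.2 hs0, (Real.sqrt_lt' one_pos).2 (by simpa using hs1), Real.sqrt_nonneg _,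
    fun B => ?_⟩
  have hentry (z : (ℕ × ℕ) × (ℕ × ℕ)) :
      ‖gram S ε W z.1 z.2 - truncate B (gram S ε W) z.1 z.2‖ ^ 2 ≤
        K * s ^ B * s ^ (z.1.1 + z.1.2 + (z.2.1 + z.2.2)) := by
    by_cases hB : B ≤ ladderDist z.1 z.2
    · rw [truncate, if_pos hB, sub_zero]
      calc ‖gram S ε W z.1 z.2‖ ^ 2
          ≤ K * (s ^ 2) ^ (z.1.1 + z.1.2 + (z.2.1 + z.2.2)) := hG _ _
        _ = K * s ^ (z.1.1 + z.1.2 + (z.2.1 + z.2.2)) *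
            s ^ (z.1.1 + z.1.2 + (z.2.1 + z.2.2)) := by ring
        _ ≤ K * s ^ B * s ^ (z.1.1 + z.1.2 + (z.2.1 + z.2.2)) := by
            have hexp := pow_le_pow_of_le_one hs0.le hs1.le (hB.trans (ladderDist_le z.1 z.2))
            exact mul_le_mul_of_nonneg_right (mul_le_mul_of_nonneg_left hexp hK)
              (pow_nonneg hs0.le _)
    · rw [truncate, if_neg hB, sub_self, norm_zero, zero_pow two_ne_zero]
      positivity
  have hsumE : Summable fun z : (ℕ × ℕ) × (ℕ × ℕ) =>
      ‖gram S ε W z.1 z.2 - truncate B (gram S ε W) z.1 z.2‖ ^ 2 :=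
    Summable.of_nonneg_of_le (fun _ => sq_nonneg _) hentry (hsum.mul_left _)
  obtain ⟨A, hA, hAn⟩ := exists_isMatrixOf_of_summable
    (M := fun p q => gram S ε W p q - truncate B (gram S ε W) p q) hsumE
  refine ⟨A, hA, hAn.trans ?_⟩
  have hpow : √s ^ B = √(s ^ B) := (Real.sqrt_eq_iff_eq_sq (by positivity) (by positivity)).2 (by
    rw [← pow_mul, mul_comm, pow_mul, Real.sq_sqrt hs0.le]) |>.symm
  rw [hpow, ← Real.sqrt_mul (by positivity)]
  refine Real.sqrt_le_sqrt ((hsumE.tsum_le_tsum hentry (hsum.mul_left _)).trans_eq ?_)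
  rw [tsum_mul_left]
  ring

end BeurlingNyman

theorem corollary7p2 (ε W : ℝ) (hε : 0 < ε) (hW : 0 < W) (S : Set ℝ)
    (hS : S = Set.Ioi 0 ∨ S = Set.Ioc 0 1) :
    ∃ G : BeurlingNyman.LadderSpace →L[ℂ] BeurlingNyman.LadderSpace,
      BeurlingNyman.IsMatrixOf (BeurlingNyman.gram S ε W) G ∧
      ∀ m : ℝ, 2 < m → ∃ C : ℝ, 0 < C ∧ ∀ B : ℕ, 1 ≤ B →
        ∃ GB : BeurlingNyman.LadderSpace →L[ℂ] BeurlingNyman.LadderSpace,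
          BeurlingNyman.IsMatrixOf
            (BeurlingNyman.truncate B (BeurlingNyman.gram S ε W)) GB ∧
          ‖G - GB‖ ≤ C * (B : ℝ) ^ (2 - m) := by
  have hS0 : S ⊆ Set.Ioi 0 := by
    rcases hS with rfl | rfl
    exacts [subset_rfl, fun x hx => hx.1]
  obtain ⟨r, C₀, hr, hr1, hC₀, hA⟩ :=
    BeurlingNyman.exists_isMatrixOf_gram_sub_truncate hS0 ε W
  -- Truncation at `B = 0` removes every entry, so its error operator is `G` itself.
  obtain ⟨G, hG, -⟩ := hA 0
  simp only [BeurlingNyman.truncate, Nat.zero_le, if_true, sub_zero] at hG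
  refine ⟨G, hG, fun m _ => ?_⟩
  obtain ⟨D, hD, hpow⟩ := BeurlingNyman.exists_pow_le_mul_rpow hr hr1 (2 - m)
  refine ⟨(C₀ + 1) * D, by positivity, fun B hB => ?_⟩
  obtain ⟨A, hAM, hAn⟩ := hA B
  refine ⟨G - A, fun x p => ?_, ?_⟩
  · have h := (hG x p).sub (hAM x p)
    simpa [sub_mul] using h
  · rw [sub_sub_cancel]
    calc ‖A‖ ≤ C₀ * r ^ B := hAn
      _ ≤ (C₀ + 1) * (D * (B : ℝ) ^ (2 - m)) := by
          gcongr
          · linarith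
          · exact hpow B hB
      _ = (C₀ + 1) * D * (B : ℝ) ^ (2 - m) := by ring
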